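/- Let $d\ge 1$ and let $\gamma(n)=(P_1(n),\dots,P_d(n))$ be a polynomial curve in $\mathbb{Z}^d$ with $P_1,\dots,P_d\in\mathbb{Z}[X]$. Let $D=\sum_{j=1}^d \deg P_j$, and for integers $N\ge 1$ and $f:\mathbb{Z}^d\to\mathbb{C}$ put $$\mathcal{A}_N f(\boldsymbol{x})=\frac1N\sum_{n=1}^N f(\boldsymbol{x}-\gamma(n)),\qquad \boldsymbol{x}\in\mathbb{Z}^d .$$ Suppose that one of the following holds: (i) $d=1$ and $\gamma=P_1$ is a quadratic polynomial, i.e. $\deg P_1=2$ (so $D=2$); (ii) $d=2$ and $\gamma=(P_1,P_2)$ is a parabola, i.e. $\deg P_1=1$ and $\deg P_2=2$ (so $D=3$). Then for every $\epsilon>0$ there is a constant $C>0$, depending only on $\epsilon$ and $\gamma$, such that for all exponents $1\le p\le q\le\infty$, all integers $N\ge1$ and all $f\in\ell^p(\mathbb{Z}^d)$, $$\|\mathcal{A}_N f\|_{\ell^q(\mathbb{Z}^d)}\le C\,N^{\epsilon}\bigl(N^{-D(1/p-1/q)}+N^{-1/q'}+N^{-1/p}\bigr)\|f\|_{\ell^p(\mathbb{Z}^d)},$$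 where $1/q'=1-1/q$ and $1/\infty=0$. -/

import Mathlib

open scoped ENNReal

noncomputable section

namespace PolyAvg

/-- The point `γ(n) = (P₁(n), …, P_d(n))` of `ℤ^d` on the polynomial curve whose components are the
integer polynomials `P = (P₁, …, P_d)`. -/
def curve {d : ℕ} (P : Fin d → Polynomial ℤ) (n : ℤ) : Fin d → ℤ :=
  fun j => (P j).eval n

/-- The total degree `D = ∑ⱼ deg Pⱼ` of the curve. -/
def totalDegree {d : ℕ} (P : Fin d → Polynomial ℤ) : ℕ :=
  ∑ j, (P j).natDegree

/-- The discrete average `A_N f (x) = (1/N) ∑_{n=1}^{N} f (x - γ(n))` of a function on `ℤ^d`. -/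
def average {d : ℕ} (P : Fin d → Polynomial ℤ) (N : ℕ) (f : (Fin d → ℤ) → ℂ) :
    (Fin d → ℤ) → ℂ :=
  fun x => (1 / (N : ℂ)) * ∑ n ∈ Finset.Icc 1 N, f (x - curve P (n : ℤ))

/-- The `ℓ^p(ℤ^d)` norm, `1 ≤ p ≤ ∞`, with values in `[0, ∞]`: the `L^p` norm for the counting
measure (the supremum of `|f|` when `p = ∞`). It is finite exactly when `f ∈ ℓ^p(ℤ^d)`. -/
def ellNorm {d : ℕ} (p : ℝ≥0∞) (f : (Fin d → ℤ) → ℂ) : ℝ≥0∞ :=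
  MeasureTheory.eLpNorm f p MeasureTheory.Measure.count

/-- The quantity `N^{-D(1/p - 1/q)} + N^{-1/q'} + N^{-1/p}`, where `1/q' = 1 - 1/q` and
`1/∞ = 0`. -/
def optimalConstant (D N : ℕ) (p q : ℝ≥0∞) : ℝ :=
  (N : ℝ) ^ (-((D : ℝ) * ((p⁻¹).toReal - (q⁻¹).toReal)))
    + (N : ℝ) ^ (-(1 - (q⁻¹).toReal))
    + (N : ℝ) ^ (-(p⁻¹).toReal)

/-- The optimal `ℓ^p → ℓ^q` bounds for the averages along the curve: for every `ε > 0` there is a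
constant `C` (depending on `ε` and on the curve only) such that
`‖A_N f‖_q ≤ C N^ε (N^{-D(1/p - 1/q)} + N^{-1/q'} + N^{-1/p}) ‖f‖_p`
for all `1 ≤ p ≤ q ≤ ∞`, all `N ≥ 1` and all `f ∈ ℓ^p(ℤ^d)`. -/
def OptimalBounds {d : ℕ} (P : Fin d → Polynomial ℤ) : Prop :=
  ∀ ε : ℝ, 0 < ε → ∃ C : ℝ, 0 < C ∧
    ∀ p q : ℝ≥0∞, 1 ≤ p → p ≤ q →
      ∀ N : ℕ, 1 ≤ N →
        ∀ f : (Fin d → ℤ) → ℂ, ellNorm p f < ∞ →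
          ellNorm q (average P N f) ≤
            ENNReal.ofReal (C * (N : ℝ) ^ ε * optimalConstant (totalDegree P) N p q)
              * ellNorm p f

end PolyAvg

end

/-!
By duality the bound is one for the form `∑ F(y - γ(n)) ^ s * G(y) ^ t` over the edges `(y, n)`,
`1 ≤ n ≤ N`, where `s = 1/p`, `t = 1 - 1/q`, and `F`, `G` are nonnegative functions of mass at
most one. No Fourier analysis is needed, since in both cases walks of three steps along the curve
that never turn straight back are scarce: if `s' = n₁ - n₂ + n₃` and `t' = n₁² - n₂² + n₃²`, then
`2 (n₁ - n₂) (n₃ - n₂) = s'² - t'`, so that by the divisor bound a point has at most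
`C N ^ (3 - D + ε)` representations `γ(n₁) - γ(n₂) + γ(n₃)` with `n₁ ≠ n₂ ≠ n₃`
(`card_walks_quadratic_le`, `card_walks_curve_parabola_le`).

Call an edge heavy if the mass at one of its ends exceeds the total mass seen from the other end
along the other edges. A point has at most one edge that is heavy at the opposite end, so the heavy
edges contribute only the terms `N ^ (1 - s)` and `N ^ (1 - t)` (`tsum_heavyTargets_le`,
`tsum_heavySources_le`). On the other edges a weighted form of Sidorenko's inequality for the path
with three edges turns the count of walks into the bound `N ^ (1 - D/3 + ε)` at `s = t = 2/3`
(`tsum_goodEdges_le`). All other exponents follow by Hölder's inequality from this one and the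
trivial bounds at `(1, 0)`, `(0, 1)`, `(1, 1)` (`tsum_rpow_mul_rpow_le_of_critical`).
-/

open scoped ENNReal

namespace PolyAvg

/-! ### The divisor bound and the number of walks along the curve -/

/-- The divisor bound `d(n) ≪ n ^ ε`. A prime power `p ^ k` contributes
`k + 1 ≤ 2 ^ k ≤ p ^ (k ε)` as soon as `p ^ ε ≥ 2`, and only boundedly many primes are smaller. -/
theorem card_divisors_le_rpow {ε : ℝ} (hε : 0 < ε) :
    ∃ C : ℝ, 1 ≤ C ∧ ∀ n : ℕ, n ≠ 0 → (n.divisors.card : ℝ) ≤ C * (n : ℝ) ^ ε := by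
  obtain ⟨P, hP⟩ := exists_nat_ge ((2 : ℝ) ^ (1 / ε))
  set B : ℝ := max 1 (1 / (ε * Real.log 2)) with hB
  have hB1 : 1 ≤ B := le_max_left _ _
  have hlog : 0 < Real.log 2 := Real.log_pos (by norm_num)
  have hBl : 1 ≤ B * (ε * Real.log 2) := by
    have := le_max_right 1 (1 / (ε * Real.log 2))
    rwa [← hB, div_le_iff₀ (by positivity)] at this
  refine ⟨B ^ P, one_le_pow₀ hB1, fun n hn => ?_⟩
  have hlocal : ∀ p ∈ n.primeFactors, ((n.factorization p + 1 : ℕ) : ℝ) ≤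
      (if p < P then B else 1) * ((p : ℝ) ^ n.factorization p) ^ ε := by
    intro p hp
    have hp2 : 2 ≤ p := (Nat.prime_of_mem_primeFactors hp).two_le
    have hp2' : (2 : ℝ) ≤ p := by exact_mod_cast hp2
    set k := n.factorization p
    have hk : (0 : ℝ) ≤ k := Nat.cast_nonneg k
    have hpow : ((p : ℝ) ^ k) ^ ε = ((p : ℝ) ^ ε) ^ k := by
      rw [← Real.rpow_natCast, ← Real.rpow_natCast, ← Real.rpow_mul (by positivity),
        ← Real.rpow_mul (by positivity), mul_comm]
    split_ifs with h
    · have h1 : 1 + k * (ε * Real.log 2) ≤ ((p : ℝ) ^ k) ^ ε := by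
        have h2 : ((2 : ℝ) ^ k) ^ ε ≤ ((p : ℝ) ^ k) ^ ε := by gcongr
        refine le_trans ?_ h2
        rw [← Real.rpow_natCast, ← Real.rpow_mul (by norm_num),
          Real.rpow_def_of_pos (by norm_num)]
        have := Real.add_one_le_exp (Real.log 2 * (k * ε))
        linarith
      push_cast
      calc (k : ℝ) + 1 ≤ B * (1 + k * (ε * Real.log 2)) := by nlinarith
        _ ≤ _ := by gcongr
    · have h1 : (2 : ℝ) ≤ (p : ℝ) ^ ε := by
        have h3 : (2 : ℝ) ^ (1 / ε) ≤ p := hP.trans (by exact_mod_cast not_lt.mp h)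
        calc (2 : ℝ) = ((2 : ℝ) ^ (1 / ε)) ^ ε := by
              rw [← Real.rpow_mul (by norm_num), one_div_mul_cancel hε.ne', Real.rpow_one]
          _ ≤ _ := by gcongr
      rw [one_mul, hpow]
      calc ((k + 1 : ℕ) : ℝ) ≤ (2 : ℝ) ^ k := by exact_mod_cast Nat.lt_two_pow_self
        _ ≤ _ := by gcongr
  have hprod : (∏ p ∈ n.primeFactors, (if p < P then B else 1)) ≤ B ^ P := by
    rw [Finset.prod_ite, Finset.prod_const_one, mul_one, Finset.prod_const]
    refine pow_le_pow_right₀ hB1 ?_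
    calc _ ≤ (Finset.range P).card :=
          Finset.card_le_card fun p hp => by simpa using (Finset.mem_filter.mp hp).2
      _ = P := Finset.card_range P
  have hfac : ∏ p ∈ n.primeFactors, ((p : ℝ) ^ n.factorization p) ^ ε = (n : ℝ) ^ ε := by
    rw [Real.finsetProd_rpow _ _ fun p _ => by positivity]
    congr 1
    have := Nat.prod_factorization_pow_eq_self hn
    rw [Finsupp.prod, Nat.support_factorization] at this
    conv_rhs => rw [← this]
    push_cast
    rfl
  rw [Nat.card_divisors hn]
  push_cast
  calc ∏ p ∈ n.primeFactors, ((n.factorization p : ℝ) + 1)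
      ≤ ∏ p ∈ n.primeFactors, (if p < P then B else 1) * ((p : ℝ) ^ n.factorization p) ^ ε :=
        Finset.prod_le_prod (fun _ _ => by positivity) fun p hp => by
          simpa using hlocal p hp
    _ ≤ B ^ P * (n : ℝ) ^ ε := by
        rw [Finset.prod_mul_distrib, hfac]
        gcongr

/-- The triples of parameters in `[1, N]` of a walk of three steps `n₁, n₂, n₃` along a curve that
never turns straight back. -/
def walks (N : ℕ) : Finset (ℕ × ℕ × ℕ) :=
  (Finset.Icc 1 N ×ˢ Finset.Icc 1 N ×ˢ Finset.Icc 1 N).filter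
    fun n => n.1 ≠ n.2.1 ∧ n.2.2 ≠ n.2.1

theorem mem_walks {N : ℕ} {n : ℕ × ℕ × ℕ} : n ∈ walks N ↔
    ((1 ≤ n.1 ∧ n.1 ≤ N) ∧ (1 ≤ n.2.1 ∧ n.2.1 ≤ N) ∧ (1 ≤ n.2.2 ∧ n.2.2 ≤ N)) ∧
      n.1 ≠ n.2.1 ∧ n.2.2 ≠ n.2.1 := by
  simp [walks]

/-- Fixing `s = n₁ - n₂ + n₃` and `t = n₁² - n₂² + n₃²` fixes the product
`(n₁ - n₂) (n₃ - n₂) = (s² - t) / 2`, which is not zero; the divisor `n₁ - n₂` of it then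
determines the walk. -/
theorem card_walks_parabola_le {ε : ℝ} (hε : 0 < ε) :
    ∃ C : ℝ, 1 ≤ C ∧ ∀ (N : ℕ) (s t : ℤ), 1 ≤ N →
      (((walks N).filter fun n => (n.1 : ℤ) - n.2.1 + n.2.2 = s ∧
        (n.1 : ℤ) ^ 2 - (n.2.1 : ℤ) ^ 2 + (n.2.2 : ℤ) ^ 2 = t).card : ℝ) ≤ C * (N : ℝ) ^ ε := by
  obtain ⟨C, hC1, hC⟩ := card_divisors_le_rpow (half_pos hε)
  refine ⟨2 * C, by linarith, fun N s t hN => ?_⟩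
  set W := (walks N).filter fun n => (n.1 : ℤ) - n.2.1 + n.2.2 = s ∧
        (n.1 : ℤ) ^ 2 - (n.2.1 : ℤ) ^ 2 + (n.2.2 : ℤ) ^ 2 = t with hW
  rcases W.eq_empty_or_nonempty with h0 | ⟨w, hw⟩
  · rw [h0]; simp; positivity
  set m : ℤ := ((w.1 : ℤ) - w.2.1) * ((w.2.2 : ℤ) - w.2.1) with hm
  have hprod : ∀ n ∈ W, ((n.1 : ℤ) - n.2.1) * ((n.2.2 : ℤ) - n.2.1) = m := by
    have key : ∀ n ∈ W, 2 * (((n.1 : ℤ) - n.2.1) * ((n.2.2 : ℤ) - n.2.1)) = s ^ 2 - t := by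
      intro n hn
      obtain ⟨-, h1, h2⟩ := Finset.mem_filter.mp hn
      rw [← h1, ← h2]; ring
    intro n hn
    have := key n hn
    have := key w hw
    omega
  obtain ⟨hwN, hne1, hne2⟩ := mem_walks.mp (Finset.mem_filter.mp hw).1
  have hm0 : m ≠ 0 := mul_ne_zero (by omega) (by omega)
  have hmN : m.natAbs ≤ N ^ 2 := by
    rw [hm, Int.natAbs_mul, sq]
    exact Nat.mul_le_mul (by omega) (by omega)
  have hm0' : m.natAbs ≠ 0 := by simpa using hm0
  let D : Finset ℤ := m.natAbs.divisors.image (fun a : ℕ => (a : ℤ)) ∪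
    m.natAbs.divisors.image (fun a : ℕ => -(a : ℤ))
  have hcard : W.card ≤ 2 * m.natAbs.divisors.card := by
    have h1 : W.card ≤ D.card := by
      refine Finset.card_le_card_of_injOn (fun n => (n.1 : ℤ) - n.2.1) ?_ ?_
      · intro n hn
        have hdvd : ((n.1 : ℤ) - n.2.1).natAbs ∈ m.natAbs.divisors :=
          Nat.mem_divisors.mpr
            ⟨Int.natAbs_dvd_natAbs.mpr ⟨_, (hprod n hn).symm⟩, hm0'⟩
        simp only [D, Finset.coe_union, Finset.coe_image, Set.mem_union, Set.mem_image,
          Finset.mem_coe]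
        rcases Int.natAbs_eq ((n.1 : ℤ) - n.2.1) with h | h
        · exact Or.inl ⟨_, hdvd, h.symm⟩
        · exact Or.inr ⟨_, hdvd, h.symm⟩
      · intro n hn n' hn' (h : (n.1 : ℤ) - n.2.1 = (n'.1 : ℤ) - n'.2.1)
        have e1 := hprod n hn
        have e2 := hprod n' hn'
        obtain ⟨hw1, h1, -⟩ := Finset.mem_filter.mp hn
        obtain ⟨-, h2, -⟩ := Finset.mem_filter.mp hn'
        have hne := (mem_walks.mp hw1).2.1
        rw [← h] at e2
        have h3 : (n.2.2 : ℤ) - n.2.1 = (n'.2.2 : ℤ) - n'.2.1 :=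
          mul_left_cancel₀ (show (n.1 : ℤ) - n.2.1 ≠ 0 by omega) (e1.trans e2.symm)
        refine Prod.ext ?_ (Prod.ext ?_ ?_) <;> omega
    calc W.card ≤ D.card := h1
      _ ≤ _ := Finset.card_union_le _ _
      _ ≤ m.natAbs.divisors.card + m.natAbs.divisors.card :=
          add_le_add Finset.card_image_le Finset.card_image_le
      _ = _ := by ring
  calc (W.card : ℝ) ≤ 2 * (m.natAbs.divisors.card : ℝ) := by exact_mod_cast hcard
    _ ≤ 2 * (C * (m.natAbs : ℝ) ^ (ε / 2)) := by gcongr; exact hC _ hm0'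
    _ ≤ 2 * (C * ((N : ℝ) ^ 2) ^ (ε / 2)) := by gcongr; exact_mod_cast hmN
    _ = 2 * C * (N : ℝ) ^ ε := by
        rw [← Real.rpow_natCast, ← Real.rpow_mul (by positivity)]
        norm_num
        ring_nf

theorem eval_of_natDegree_eq_two {p : Polynomial ℤ} (hp : p.natDegree = 2) (n : ℤ) :
    p.eval n = p.coeff 2 * n ^ 2 + p.coeff 1 * n + p.coeff 0 := by
  rw [Polynomial.eval_eq_sum_range, hp]
  simp [Finset.sum_range_succ]
  ring

theorem coeff_two_ne_zero {p : Polynomial ℤ} (hp : p.natDegree = 2) : p.coeff 2 ≠ 0 := by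
  have : p ≠ 0 := fun h => by simp [h] at hp
  simpa [Polynomial.leadingCoeff, hp] using Polynomial.leadingCoeff_ne_zero.mpr this

theorem card_eval_eq_le_two {p : Polynomial ℤ} (hp : p.natDegree = 2) (N : ℕ) (z : ℤ) :
    ((Finset.Icc 1 N).filter fun n : ℕ => p.eval (n : ℤ) = z).card ≤ 2 := by
  have hdeg : (p - Polynomial.C z).natDegree = 2 := by rw [Polynomial.natDegree_sub_C, hp]
  have h0 : p - Polynomial.C z ≠ 0 := fun h => by
    rw [h, Polynomial.natDegree_zero] at hdeg
    omega
  calc _ ≤ (p - Polynomial.C z).roots.toFinset.card := by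
        refine Finset.card_le_card_of_injOn (fun n : ℕ => (n : ℤ)) ?_ ?_
        · intro n hn
          have := (Finset.mem_filter.mp hn).2
          rw [Finset.mem_coe, Multiset.mem_toFinset, Polynomial.mem_roots h0, Polynomial.IsRoot.def,
            Polynomial.eval_sub, Polynomial.eval_C, this, sub_self]
        · exact fun _ _ _ _ h => Nat.cast_injective h
    _ ≤ (p - Polynomial.C z).roots.card := Multiset.toFinset_card_le _
    _ ≤ 2 := hdeg ▸ Polynomial.card_roots' _

/-- In dimension one the value of `n₁ - n₂ + n₃`, one of `O(N)` integers, is free. -/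
theorem card_walks_quadratic_le {ε : ℝ} (hε : 0 < ε) :
    ∃ C : ℝ, 1 ≤ C ∧ ∀ (P : Fin 1 → Polynomial ℤ), (P 0).natDegree = 2 →
      ∀ (N : ℕ) (v : Fin 1 → ℤ), 1 ≤ N →
      (((walks N).filter fun n => curve P n.1 - curve P n.2.1 + curve P n.2.2 = v).card : ℝ) ≤
        C * (N : ℝ) ^ (3 - (2 : ℝ) + ε) := by
  obtain ⟨C, hC1, hC⟩ := card_walks_parabola_le hε
  refine ⟨3 * C, by linarith, fun P hP N v hN => ?_⟩
  set W := (walks N).filter fun n => curve P n.1 - curve P n.2.1 + curve P n.2.2 = v with hW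
  have hmaps : ∀ n ∈ W, (n.1 : ℤ) - n.2.1 + n.2.2 ∈ Finset.Ioo (-(N : ℤ)) (2 * N) := by
    intro n hn
    have := (mem_walks.mp (Finset.mem_filter.mp hn).1).1
    rw [Finset.mem_Ioo]
    omega
  have hfib : ∀ s ∈ Finset.Ioo (-(N : ℤ)) (2 * N),
      ((W.filter fun n => (n.1 : ℤ) - n.2.1 + n.2.2 = s).card : ℝ) ≤ C * (N : ℝ) ^ ε := by
    intro s _
    rcases (W.filter fun n => (n.1 : ℤ) - n.2.1 + n.2.2 = s).eq_empty_or_nonempty with h0 | ⟨w, hw⟩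
    · rw [h0]; simp; positivity
    refine le_trans ?_ (hC N s ((w.1 : ℤ) ^ 2 - (w.2.1 : ℤ) ^ 2 + (w.2.2 : ℤ) ^ 2) hN)
    have key : ∀ n ∈ W.filter fun n => (n.1 : ℤ) - n.2.1 + n.2.2 = s,
        (P 0).coeff 2 * ((n.1 : ℤ) ^ 2 - (n.2.1 : ℤ) ^ 2 + (n.2.2 : ℤ) ^ 2) =
          v 0 - (P 0).coeff 1 * s - (P 0).coeff 0 := by
      intro n hn
      obtain ⟨hn, hs⟩ := Finset.mem_filter.mp hn
      have := congrFun (Finset.mem_filter.mp hn).2 0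
      simp only [curve, Pi.add_apply, Pi.sub_apply, eval_of_natDegree_eq_two hP] at this
      rw [← this, ← hs]
      ring
    refine Nat.cast_le.mpr (Finset.card_le_card fun n hn => ?_)
    have h1 := mul_left_cancel₀ (coeff_two_ne_zero hP) ((key n hn).trans (key w hw).symm)
    obtain ⟨hn, hs⟩ := Finset.mem_filter.mp hn
    exact Finset.mem_filter.mpr ⟨(Finset.mem_filter.mp hn).1, hs, h1⟩
  calc (W.card : ℝ) = ∑ s ∈ Finset.Ioo (-(N : ℤ)) (2 * N),
        ((W.filter fun n => (n.1 : ℤ) - n.2.1 + n.2.2 = s).card : ℝ) := by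
        exact_mod_cast Finset.card_eq_sum_card_fiberwise hmaps
    _ ≤ ∑ s ∈ Finset.Ioo (-(N : ℤ)) (2 * N), C * (N : ℝ) ^ ε := Finset.sum_le_sum hfib
    _ = ((2 * (N : ℤ) - -(N : ℤ) - 1).toNat : ℝ) * (C * (N : ℝ) ^ ε) := by
        rw [Finset.sum_const, Int.card_Ioo, nsmul_eq_mul]
    _ ≤ (3 * N : ℝ) * (C * (N : ℝ) ^ ε) := by
        gcongr
        have : (2 * (N : ℤ) - -(N : ℤ) - 1).toNat ≤ 3 * N := by omega
        exact_mod_cast this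
    _ = 3 * C * (N : ℝ) ^ (3 - (2 : ℝ) + ε) := by
        rw [Real.rpow_add (by positivity)]
        norm_num
        ring

/-- On a parabola in the plane the first coordinate determines `n₁ - n₂ + n₃`, and then the second
one determines `n₁² - n₂² + n₃²`. -/
theorem card_walks_curve_parabola_le {ε : ℝ} (hε : 0 < ε) :
    ∃ C : ℝ, 1 ≤ C ∧ ∀ (P : Fin 2 → Polynomial ℤ), (P 0).natDegree = 1 → (P 1).natDegree = 2 →
      ∀ (N : ℕ) (v : Fin 2 → ℤ), 1 ≤ N →
      (((walks N).filter fun n => curve P n.1 - curve P n.2.1 + curve P n.2.2 = v).card : ℝ) ≤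
        C * (N : ℝ) ^ (3 - (3 : ℝ) + ε) := by
  obtain ⟨C, hC1, hC⟩ := card_walks_parabola_le hε
  refine ⟨C, hC1, fun P hP0 hP1 N v hN => ?_⟩
  set W := (walks N).filter fun n => curve P n.1 - curve P n.2.1 + curve P n.2.2 = v with hW
  rcases W.eq_empty_or_nonempty with h0 | ⟨w, hw⟩
  · rw [h0]; simp; positivity
  rw [sub_self, zero_add]
  refine le_trans ?_ (hC N ((w.1 : ℤ) - w.2.1 + w.2.2)
    ((w.1 : ℤ) ^ 2 - (w.2.1 : ℤ) ^ 2 + (w.2.2 : ℤ) ^ 2) hN)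
  have heval : ∀ n : ℤ, (P 0).eval n = (P 0).coeff 1 * n + (P 0).coeff 0 := by
    intro n
    rw [Polynomial.eval_eq_sum_range, hP0]
    simp [Finset.sum_range_succ]
    ring
  have hlead : (P 0).coeff 1 ≠ 0 := by
    have : P 0 ≠ 0 := fun h => by simp [h] at hP0
    simpa [Polynomial.leadingCoeff, hP0] using Polynomial.leadingCoeff_ne_zero.mpr this
  have key0 : ∀ n ∈ W, (P 0).coeff 1 * ((n.1 : ℤ) - n.2.1 + n.2.2) = v 0 - (P 0).coeff 0 := by
    intro n hn
    have := congrFun (Finset.mem_filter.mp hn).2 0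
    simp only [curve, Pi.add_apply, Pi.sub_apply, heval] at this
    rw [← this]
    ring
  have hs : ∀ n ∈ W, (n.1 : ℤ) - n.2.1 + n.2.2 = (w.1 : ℤ) - w.2.1 + w.2.2 := fun n hn =>
    mul_left_cancel₀ hlead ((key0 n hn).trans (key0 w hw).symm)
  have key1 : ∀ n ∈ W, (P 1).coeff 2 * ((n.1 : ℤ) ^ 2 - (n.2.1 : ℤ) ^ 2 + (n.2.2 : ℤ) ^ 2) =
      v 1 - (P 1).coeff 1 * ((w.1 : ℤ) - w.2.1 + w.2.2) - (P 1).coeff 0 := by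
    intro n hn
    have := congrFun (Finset.mem_filter.mp hn).2 1
    simp only [curve, Pi.add_apply, Pi.sub_apply, eval_of_natDegree_eq_two hP1] at this
    rw [← this, ← hs n hn]
    ring
  exact Nat.cast_le.mpr <| Finset.card_le_card fun n hn =>
    Finset.mem_filter.mpr ⟨(Finset.mem_filter.mp hn).1, hs n hn,
      mul_left_cancel₀ (coeff_two_ne_zero hP1) ((key1 n hn).trans (key1 w hw).symm)⟩

/-! ### Interpolation for sums of nonnegative terms -/

theorem tsum_rpow_mul_rpow_le {α : Type*} (u v : α → ℝ≥0∞) {a b : ℝ} (ha : 0 ≤ a) (hb : 0 ≤ b)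
    (hab : a + b = 1) : ∑' e, u e ^ a * v e ^ b ≤ (∑' e, u e) ^ a * (∑' e, v e) ^ b := by
  let _ : MeasurableSpace α := ⊤
  simpa [MeasureTheory.lintegral_count] using
    ENNReal.lintegral_mul_norm_pow_le (μ := MeasureTheory.Measure.count) (f := u) (g := v)
      (Measurable.of_discrete).aemeasurable (Measurable.of_discrete).aemeasurable ha hb hab

theorem tsum_rpow_mul_rpow_mul_rpow_le {α : Type*} (u v w : α → ℝ≥0∞) {a b c : ℝ} (ha : 0 ≤ a)
    (hb : 0 ≤ b) (hc : 0 ≤ c) (habc : a + b + c = 1) :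
    ∑' e, u e ^ a * v e ^ b * w e ^ c ≤
      (∑' e, u e) ^ a * (∑' e, v e) ^ b * (∑' e, w e) ^ c := by
  let _ : MeasurableSpace α := ⊤
  have h := ENNReal.lintegral_prod_norm_pow_le
    (μ := (MeasureTheory.Measure.count : MeasureTheory.Measure α))
    (Finset.univ : Finset (Fin 3)) (f := ![u, v, w]) (p := ![a, b, c])
    (fun _ _ => (Measurable.of_discrete).aemeasurable)
    (by simpa [Fin.sum_univ_three] using habc)
    (by intro i _; fin_cases i <;> simpa)
  simpa [MeasureTheory.lintegral_count, Fin.prod_univ_three] using h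

/-- The case of `tsum_rpow_mul_rpow_le_of_critical` in which `(s, t)` lies in the triangle with
vertices `(1, 0)`, `(0, 1)`, `(2/3, 2/3)`. -/
theorem tsum_rpow_mul_rpow_le_of_triangle {α : Type*} {u v : α → ℝ≥0∞} {N B : ℝ≥0∞} {D s t : ℝ}
    (hN : 1 ≤ N) (hN' : N ≠ ∞) (hB : 1 ≤ B) (hu : ∑' e, u e ≤ N) (hv : ∑' e, v e ≤ N)
    (h : ∑' e, (u e * v e) ^ (2 / 3 : ℝ) ≤ B * N ^ (1 - D / 3))
    (hst : 1 ≤ s + t) (h1 : s + 2 * t ≤ 2) (h2 : 2 * s + t ≤ 2) :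
    ∑' e, u e ^ s * v e ^ t ≤ B * N ^ (1 - D * (s + t - 1)) := by
  have hN0 : N ≠ 0 := (zero_lt_one.trans_le hN).ne'
  have ha : 0 ≤ 2 - s - 2 * t := by linarith
  have hb : 0 ≤ 2 - 2 * s - t := by linarith
  have hθ : 0 ≤ 3 * (s + t - 1) := by linarith
  calc ∑' e, u e ^ s * v e ^ t
      = ∑' e, u e ^ (2 - s - 2 * t) * v e ^ (2 - 2 * s - t) *
          ((u e * v e) ^ (2 / 3 : ℝ)) ^ (3 * (s + t - 1)) := by
        congr 1 with e
        rw [← ENNReal.rpow_mul, ENNReal.mul_rpow_of_nonneg _ _ (by linarith),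
          mul_mul_mul_comm, ← ENNReal.rpow_add_of_nonneg _ _ ha (by linarith),
          ← ENNReal.rpow_add_of_nonneg _ _ hb (by linarith)]
        ring_nf
    _ ≤ (∑' e, u e) ^ (2 - s - 2 * t) * (∑' e, v e) ^ (2 - 2 * s - t) *
          (∑' e, (u e * v e) ^ (2 / 3 : ℝ)) ^ (3 * (s + t - 1)) :=
        tsum_rpow_mul_rpow_mul_rpow_le _ _ _ ha hb hθ (by ring)
    _ ≤ N ^ (2 - s - 2 * t) * N ^ (2 - 2 * s - t) *
          (B * N ^ (1 - D / 3)) ^ (3 * (s + t - 1)) := by gcongr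
    _ = B ^ (3 * (s + t - 1)) * N ^ (1 - D * (s + t - 1)) := by
        rw [ENNReal.mul_rpow_of_nonneg _ _ hθ, ← ENNReal.rpow_mul, mul_left_comm,
          ← ENNReal.rpow_add _ _ hN0 hN', ← ENNReal.rpow_add _ _ hN0 hN']
        ring_nf
    _ ≤ B * N ^ (1 - D * (s + t - 1)) := by
        gcongr
        calc B ^ (3 * (s + t - 1)) ≤ B ^ (1 : ℝ) :=
              ENNReal.rpow_le_rpow_of_exponent_le hB (by linarith)
          _ = B := ENNReal.rpow_one B

/-- The case of `tsum_rpow_mul_rpow_le_of_critical` in which `(s, t)` lies above the triangle with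
vertices `(1, 0)`, `(0, 1)`, `(2/3, 2/3)`: the exponent `t` is lowered until the triangle is met. -/
theorem tsum_rpow_mul_rpow_le_of_above {α : Type*} {u v : α → ℝ≥0∞} {N B : ℝ≥0∞} {D s t : ℝ}
    (hN : 1 ≤ N) (hN' : N ≠ ∞) (hB : 1 ≤ B) (hD : 2 ≤ D) (hv1 : ∀ e, v e ≤ 1)
    (hu : ∑' e, u e ≤ N) (hv : ∑' e, v e ≤ N)
    (h : ∑' e, (u e * v e) ^ (2 / 3 : ℝ) ≤ B * N ^ (1 - D / 3))
    (hs : 0 ≤ s) (h1 : 2 ≤ s + 2 * t) (h2 : s ≤ 2 / 3) :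
    ∑' e, u e ^ s * v e ^ t ≤ B * N ^ (1 - s) := by
  calc ∑' e, u e ^ s * v e ^ t ≤ ∑' e, u e ^ s * v e ^ (1 - s / 2) := by
        refine ENNReal.tsum_le_tsum fun e => ?_
        gcongr _ * ?_
        exact ENNReal.rpow_le_rpow_of_exponent_ge (hv1 e) (by linarith)
    _ ≤ B * N ^ (1 - D * (s + (1 - s / 2) - 1)) :=
        tsum_rpow_mul_rpow_le_of_triangle hN hN' hB hu hv h (by linarith) (by linarith)
          (by linarith)
    _ ≤ B * N ^ (1 - s) := by
        gcongr 2
        nlinarith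

/-- From bounds for `∑ u ^ s v ^ t` at the four exponents `(1, 0)`, `(0, 1)`, `(2/3, 2/3)` and
`(1, 1)`, bounds at all exponents: by Hölder's inequality the sums are logarithmically convex
in `(s, t)`, and they decrease in `s` and in `t` because `u, v ≤ 1`. -/
theorem tsum_rpow_mul_rpow_le_of_critical {α : Type*} {u v : α → ℝ≥0∞} {N B : ℝ≥0∞} {D s t : ℝ}
    (hN : 1 ≤ N) (hN' : N ≠ ∞) (hB : 1 ≤ B) (hB' : B ≠ ∞) (hD : 2 ≤ D)
    (hu1 : ∀ e, u e ≤ 1) (hv1 : ∀ e, v e ≤ 1)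
    (hu : ∑' e, u e ≤ N) (hv : ∑' e, v e ≤ N) (huv : ∑' e, u e * v e ≤ B)
    (h : ∑' e, (u e * v e) ^ (2 / 3 : ℝ) ≤ B * N ^ (1 - D / 3))
    (hs : 0 ≤ s) (hs1 : s ≤ 1) (ht : 0 ≤ t) (hst : 1 ≤ s + t) :
    ∑' e, u e ^ s * v e ^ t ≤ B * (N ^ (1 - D * (s + t - 1)) + N ^ (1 - t) + N ^ (1 - s)) := by
  have hN0 : N ≠ 0 := (zero_lt_one.trans_le hN).ne'
  have hB0 : B ≠ 0 := (zero_lt_one.trans_le hB).ne'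
  by_cases hA : s + 2 * t ≤ 2 ∧ 2 * s + t ≤ 2
  · refine (tsum_rpow_mul_rpow_le_of_triangle hN hN' hB hu hv h hst hA.1 hA.2).trans ?_
    gcongr
    exact le_self_add.trans le_self_add
  by_cases hC : 2 / 3 ≤ s ∧ 2 / 3 ≤ t
  · set m := min s t with hm
    have hm2 : 2 / 3 ≤ m := le_min hC.1 hC.2
    have hm1 : m ≤ 1 := (min_le_left _ _).trans hs1
    have h1 : ∑' e, u e ^ s * v e ^ t ≤ B * N ^ (1 - m) := by
      calc ∑' e, u e ^ s * v e ^ t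
          ≤ ∑' e, ((u e * v e) ^ (2 / 3 : ℝ)) ^ (3 - 3 * m) * (u e * v e) ^ (3 * m - 2) := by
            refine ENNReal.tsum_le_tsum fun e => ?_
            calc u e ^ s * v e ^ t ≤ u e ^ m * v e ^ m := by
                  gcongr ?_ * ?_
                  · exact ENNReal.rpow_le_rpow_of_exponent_ge (hu1 e) (min_le_left _ _)
                  · exact ENNReal.rpow_le_rpow_of_exponent_ge (hv1 e) (min_le_right _ _)
              _ = _ := by
                  rw [← ENNReal.rpow_mul, ← ENNReal.rpow_add_of_nonneg _ _ (by linarith)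
                    (by linarith), ← ENNReal.mul_rpow_of_nonneg _ _ (by linarith)]
                  ring_nf
        _ ≤ (∑' e, (u e * v e) ^ (2 / 3 : ℝ)) ^ (3 - 3 * m) *
              (∑' e, u e * v e) ^ (3 * m - 2) :=
            tsum_rpow_mul_rpow_le _ _ (by linarith) (by linarith) (by ring)
        _ ≤ (B * N ^ (1 - D / 3)) ^ (3 - 3 * m) * B ^ (3 * m - 2) := by
            gcongr <;> linarith
        _ = B ^ ((3 - 3 * m) + (3 * m - 2)) * N ^ ((1 - D / 3) * (3 - 3 * m)) := by
            rw [ENNReal.mul_rpow_of_nonneg _ _ (by linarith), ← ENNReal.rpow_mul,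
              ENNReal.rpow_add _ _ hB0 hB']
            ring
        _ ≤ B * N ^ (1 - m) := by
            rw [show (3 - 3 * m) + (3 * m - 2) = 1 by ring, ENNReal.rpow_one]
            gcongr 2
            nlinarith
    refine h1.trans ?_
    gcongr
    rcases min_choice s t with h | h <;> rw [hm, h]
    · exact le_add_self
    · exact le_add_self.trans le_self_add
  by_cases h2 : 2 ≤ s + 2 * t ∧ s ≤ 2 / 3
  · refine (tsum_rpow_mul_rpow_le_of_above hN hN' hB hD hv1 hu hv h hs h2.1 h2.2).trans ?_
    gcongr
    exact le_add_self
  have h3 : 2 ≤ t + 2 * s ∧ t ≤ 2 / 3 := by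
    by_contra h3
    simp only [not_and_or, not_le] at hA hC h2 h3
    grind
  have h4 := tsum_rpow_mul_rpow_le_of_above hN hN' hB hD hu1 hv hu
    (by simpa only [mul_comm] using h) ht h3.1 h3.2
  simp only [mul_comm (v _ ^ t)] at h4
  refine h4.trans ?_
  gcongr
  exact le_add_self.trans le_self_add

/-! ### The incidence form of a finite family of translations -/

theorem sum_comp_le_mul_tsum {τ A : Type*} [DecidableEq A] (T : Finset τ) (g : τ → A)
    (f : A → ℝ≥0∞) {R : ℝ≥0∞} (hR : ∀ a, ((T.filter fun i => g i = a).card : ℝ≥0∞) ≤ R) :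
    ∑ i ∈ T, f (g i) ≤ R * ∑' a, f a := by
  rw [Finset.sum_comp]
  calc ∑ b ∈ T.image g, (T.filter fun i => g i = b).card • f b
      ≤ ∑ b ∈ T.image g, R * f b := by
        refine Finset.sum_le_sum fun b _ => ?_
        rw [nsmul_eq_mul]
        gcongr
        exact hR b
    _ = R * ∑ b ∈ T.image g, f b := by rw [Finset.mul_sum]
    _ ≤ R * ∑' a, f a := by gcongr; exact ENNReal.sum_le_tsum _

theorem tsum_prod_fintype {A ι : Type*} [Fintype ι] (h : A × ι → ℝ≥0∞) :
    ∑' e, h e = ∑ n, ∑' y, h (y, n) := by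
  rw [ENNReal.tsum_prod', ENNReal.tsum_comm, tsum_fintype]

theorem tsum_target {A ι : Type*} [Fintype ι] (G : A → ℝ≥0∞) :
    ∑' e : A × ι, G e.1 = Fintype.card ι * ∑' y, G y := by
  rw [tsum_prod_fintype]
  simp

section Incidence

variable {A ι : Type*} [AddCommGroup A] [Fintype ι]

theorem tsum_sub_right (f : A → ℝ≥0∞) (a : A) : ∑' y, f (y - a) = ∑' y, f y :=
  (Equiv.subRight a).tsum_eq f

theorem tsum_prod_shear (γ : ι → A) (h : A × ι → ℝ≥0∞) :
    ∑' e, h e = ∑' x, ∑ n, h (x + γ n, n) := by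
  have h1 : ∀ n, ∑' y, h (y, n) = ∑' x, h (x + γ n, n) := fun n =>
    ((Equiv.addRight (γ n)).tsum_eq fun y => h (y, n)).symm
  rw [tsum_prod_fintype, Finset.sum_congr rfl fun n _ => h1 n]
  exact (Summable.tsum_finsetSum fun _ _ => ENNReal.summable).symm

variable (γ : ι → A) (F G : A → ℝ≥0∞)

theorem tsum_sub_left (f : A → ℝ≥0∞) (a : A) : ∑' z, f (a - z) = ∑' y, f y :=
  (Equiv.subLeft a).tsum_eq f

theorem tsum_source : ∑' e : A × ι, F (e.1 - γ e.2) = Fintype.card ι * ∑' x, F x := by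
  rw [tsum_prod_fintype, Finset.sum_congr rfl fun n _ => tsum_sub_right F (γ n)]
  simp

theorem tsum_source_mul_target_le [DecidableEq A] {R : ℝ≥0∞}
    (hR : ∀ z, ((Finset.univ.filter fun n => γ n = z).card : ℝ≥0∞) ≤ R) :
    ∑' e : A × ι, F (e.1 - γ e.2) * G e.1 ≤ R * (∑' x, F x) * ∑' y, G y := by
  rw [ENNReal.tsum_prod', ← ENNReal.tsum_mul_left]
  refine ENNReal.tsum_le_tsum fun y => ?_
  rw [tsum_fintype]
  simp only []
  rw [← Finset.sum_mul]
  gcongr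
  refine (sum_comp_le_mul_tsum Finset.univ γ (fun z => F (y - z)) hR).trans_eq ?_
  rw [tsum_sub_left F y]

variable [DecidableEq ι]

/-- The mass of `G` that is seen from the source `x = y - γ n` of the edge `e = (y, n)` along the
other edges issuing from `x`. -/
noncomputable def otherTargets (e : A × ι) : ℝ≥0∞ :=
  ∑ m ∈ Finset.univ.erase e.2, G (e.1 - γ e.2 + γ m)

/-- The mass of `F` that is seen from the target `y` of the edge `e = (y, n)` along the other edges
ending at `y`. -/
noncomputable def otherSources (e : A × ι) : ℝ≥0∞ :=
  ∑ k ∈ Finset.univ.erase e.2, F (e.1 - γ k)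

theorem target_add_otherTargets (e : A × ι) :
    G e.1 + otherTargets γ G e = ∑ m, G (e.1 - γ e.2 + γ m) := by
  rw [otherTargets, ← Finset.add_sum_erase _ _ (Finset.mem_univ e.2)]
  simp

theorem source_add_otherSources (e : A × ι) :
    F (e.1 - γ e.2) + otherSources γ F e = ∑ k, F (e.1 - γ k) := by
  rw [otherSources, ← Finset.add_sum_erase _ _ (Finset.mem_univ e.2)]

/-- The sum of `otherTargets * otherSources` counts walks of three steps that do not turn straight
back, with weight `G` at one end and weight `F` at the other. -/
theorem tsum_otherTargets_mul_otherSources_le [DecidableEq A] {R : ℝ≥0∞}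
    (hR : ∀ v, (((Finset.univ.filter fun n : ι × ι × ι => n.1 ≠ n.2.1 ∧ n.2.2 ≠ n.2.1).filter
      fun n => γ n.1 - γ n.2.1 + γ n.2.2 = v).card : ℝ≥0∞) ≤ R) :
    ∑' e, otherTargets γ G e * otherSources γ F e ≤ R * (∑' x, F x) * ∑' y, G y := by
  set T := Finset.univ.filter fun n : ι × ι × ι => n.1 ≠ n.2.1 ∧ n.2.2 ≠ n.2.1 with hT
  have hshift : ∀ n m k : ι, ∑' y, G (y - γ n + γ m) * F (y - γ k) =
      ∑' y, G y * F (y - (γ m - γ n + γ k)) := fun n m k => by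
    rw [← (Equiv.addRight (γ m - γ n)).tsum_eq fun y => G y * F (y - (γ m - γ n + γ k))]
    congr 1 with y
    simp only [Equiv.coe_addRight]
    congr 2 <;> abel
  calc ∑' e, otherTargets γ G e * otherSources γ F e
      = ∑ n, ∑ m ∈ Finset.univ.erase n, ∑ k ∈ Finset.univ.erase n,
          ∑' y, G y * F (y - (γ m - γ n + γ k)) := by
        rw [tsum_prod_fintype]
        refine Finset.sum_congr rfl fun n _ => ?_
        simp only [otherTargets, otherSources, Finset.sum_mul_sum]
        rw [Summable.tsum_finsetSum fun _ _ => ENNReal.summable]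
        refine Finset.sum_congr rfl fun m _ => ?_
        rw [Summable.tsum_finsetSum fun _ _ => ENNReal.summable]
        exact Finset.sum_congr rfl fun k _ => hshift n m k
    _ = ∑ τ ∈ T, ∑' y, G y * F (y - (γ τ.1 - γ τ.2.1 + γ τ.2.2)) := by
        rw [hT, Finset.sum_filter, Fintype.sum_prod_type, Finset.sum_congr rfl
          fun m _ => Fintype.sum_prod_type _, Finset.sum_comm]
        refine Finset.sum_congr rfl fun n _ => ?_
        simp only [← Finset.filter_ne', Finset.sum_filter, ite_and]
        refine Finset.sum_congr rfl fun m _ => ?_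
        split_ifs <;> simp
    _ = ∑' y, G y * ∑ τ ∈ T, F (y - (γ τ.1 - γ τ.2.1 + γ τ.2.2)) := by
        rw [← Summable.tsum_finsetSum fun _ _ => ENNReal.summable]
        simp only [Finset.mul_sum]
    _ ≤ ∑' y, G y * (R * ∑' x, F x) := by
        refine ENNReal.tsum_le_tsum fun y => ?_
        gcongr
        refine (sum_comp_le_mul_tsum T (fun τ => γ τ.1 - γ τ.2.1 + γ τ.2.2)
          (fun z => F (y - z)) hR).trans_eq ?_
        rw [tsum_sub_left F y]
    _ = R * (∑' x, F x) * ∑' y, G y := by rw [ENNReal.tsum_mul_right, mul_comm]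

/-- The edges whose two ends carry no more mass than the other edges at the opposite end see. -/
def goodEdges : Set (A × ι) :=
  {e | G e.1 ≤ otherTargets γ G e ∧ F (e.1 - γ e.2) ≤ otherSources γ F e}

/-- The edges whose target carries more mass of `G` than all other targets seen from its source
together. -/
def heavyTargets : Set (A × ι) := {e | otherTargets γ G e < G e.1}

/-- The edges whose source carries more mass of `F` than all other sources seen from its target
together. -/
def heavySources : Set (A × ι) := {e | otherSources γ F e < F (e.1 - γ e.2)}

/-- Each source has at most one edge with heavy target. -/
theorem tsum_heavyTargets_le :
    ∑' e : heavyTargets γ G, F (e.1.1 - γ e.1.2) ≤ ∑' x, F x := by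
  refine ENNReal.tsum_comp_le_tsum_of_injective
    (f := fun e : heavyTargets γ G => e.1.1 - γ e.1.2) ?_ F
  rintro ⟨⟨y, n⟩, h⟩ ⟨⟨y', n'⟩, h'⟩ (hxy : y - γ n = y' - γ n')
  suffices hn : n = n' by
    subst hn
    simpa using hxy
  by_contra hne
  simp only [heavyTargets, otherTargets, Set.mem_ofPred_eq] at h h'
  have h1 : G y' ≤ ∑ m ∈ Finset.univ.erase n, G (y - γ n + γ m) := by
    have := Finset.single_le_sum (f := fun m => G (y - γ n + γ m)) (fun _ _ => zero_le)
      (Finset.mem_erase.mpr ⟨Ne.symm hne, Finset.mem_univ n'⟩)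
    simpa [hxy] using this
  have h2 : G y ≤ ∑ m ∈ Finset.univ.erase n', G (y' - γ n' + γ m) := by
    have := Finset.single_le_sum (f := fun m => G (y' - γ n' + γ m)) (fun _ _ => zero_le)
      (Finset.mem_erase.mpr ⟨hne, Finset.mem_univ n⟩)
    simpa [← hxy] using this
  exact lt_irrefl _ (((h1.trans_lt h).trans_le h2).trans h')

/-- Each target has at most one edge with heavy source. -/
theorem tsum_heavySources_le :
    ∑' e : heavySources γ F, G e.1.1 ≤ ∑' y, G y := by
  refine ENNReal.tsum_comp_le_tsum_of_injective (f := fun e : heavySources γ F => e.1.1) ?_ G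
  rintro ⟨⟨y, n⟩, h⟩ ⟨⟨y', n'⟩, h'⟩ (hy : y = y')
  subst hy
  suffices hn : n = n' by rw [Subtype.mk.injEq, hn]
  by_contra hne
  simp only [heavySources, otherSources, Set.mem_ofPred_eq] at h h'
  have h1 : F (y - γ n') ≤ ∑ k ∈ Finset.univ.erase n, F (y - γ k) :=
    Finset.single_le_sum (f := fun k => F (y - γ k)) (fun _ _ => zero_le)
      (Finset.mem_erase.mpr ⟨Ne.symm hne, Finset.mem_univ n'⟩)
  have h2 : F (y - γ n) ≤ ∑ k ∈ Finset.univ.erase n', F (y - γ k) :=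
    Finset.single_le_sum (f := fun k => F (y - γ k)) (fun _ _ => zero_le)
      (Finset.mem_erase.mpr ⟨hne, Finset.mem_univ n⟩)
  exact lt_irrefl _ (((h1.trans_lt h).trans_le h2).trans h')

theorem rpow_two_thirds_le {u v D E : ℝ≥0∞} (hu : u ≤ E) (hv : v ≤ D) (hD : D ≠ ∞) (hE : E ≠ ∞) :
    (u * v) ^ (2 / 3 : ℝ) ≤
      (D * E) ^ (1 / 3 : ℝ) * (u * v / D) ^ (1 / 3 : ℝ) * (u * v / E) ^ (1 / 3 : ℝ) := by
  rcases eq_or_ne u 0 with rfl | hu0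
  · simp
  rcases eq_or_ne v 0 with rfl | hv0
  · simp
  have hE0 : E ≠ 0 := ((pos_iff_ne_zero.mpr hu0).trans_le hu).ne'
  have hD0 : D ≠ 0 := ((pos_iff_ne_zero.mpr hv0).trans_le hv).ne'
  rw [← ENNReal.mul_rpow_of_nonneg _ _ (by norm_num),
    ← ENNReal.mul_rpow_of_nonneg _ _ (by norm_num)]
  have : D * E * (u * v / D) * (u * v / E) = (u * v) ^ (2 : ℝ) := by
    calc D * E * (u * v / D) * (u * v / E)
        = (u * v) * (u * v) * (D * D⁻¹) * (E * E⁻¹) := by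
          simp only [div_eq_mul_inv]; ring
      _ = (u * v) ^ (2 : ℝ) := by
          rw [ENNReal.mul_inv_cancel hD0 hD, ENNReal.mul_inv_cancel hE0 hE, mul_one, mul_one,
            ENNReal.rpow_two, sq]
  rw [this, ← ENNReal.rpow_mul]
  norm_num

/-- The estimate at the critical exponents `(2/3, 2/3)`, for the good edges. With `D` and `E` the
full masses seen from the source and from the target of an edge, Hölder's inequality for
`(F G)^{2/3} = (D E)^{1/3} (F G / D)^{1/3} (F G / E)^{1/3}` leaves `∑ D E`, which on the good edges
is at most four times the weighted number of walks that do not turn straight back. -/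
theorem tsum_goodEdges_le [DecidableEq A] {R : ℝ≥0∞} (hF : ∑' x, F x ≤ 1) (hG : ∑' y, G y ≤ 1)
    (hR : ∀ v, (((Finset.univ.filter fun n : ι × ι × ι => n.1 ≠ n.2.1 ∧ n.2.2 ≠ n.2.1).filter
      fun n => γ n.1 - γ n.2.1 + γ n.2.2 = v).card : ℝ≥0∞) ≤ R) :
    ∑' e : goodEdges γ F G, (F (e.1.1 - γ e.1.2) * G e.1.1) ^ (2 / 3 : ℝ) ≤
      (4 * R) ^ (1 / 3 : ℝ) := by
  set D : A × ι → ℝ≥0∞ := fun e => ∑ m, G (e.1 - γ e.2 + γ m) with hD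
  set E : A × ι → ℝ≥0∞ := fun e => ∑ k, F (e.1 - γ k) with hE
  have hFt : ∀ x, F x ≠ ∞ := fun x =>
    ne_top_of_le_ne_top ENNReal.one_ne_top ((ENNReal.le_tsum x).trans hF)
  have hGt : ∀ y, G y ≠ ∞ := fun y =>
    ne_top_of_le_ne_top ENNReal.one_ne_top ((ENNReal.le_tsum y).trans hG)
  have hDt : ∀ e, D e ≠ ∞ := fun e => ENNReal.sum_ne_top.mpr fun m _ => hGt _
  have hEt : ∀ e, E e ≠ ∞ := fun e => ENNReal.sum_ne_top.mpr fun m _ => hFt _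
  have hDsum : ∀ e, G e.1 + otherTargets γ G e = D e := target_add_otherTargets γ G
  have hEsum : ∀ e, F (e.1 - γ e.2) + otherSources γ F e = E e := source_add_otherSources γ F
  have hDE : ∑' e : goodEdges γ F G, D e.1 * E e.1 ≤ 4 * R := by
    calc ∑' e : goodEdges γ F G, D e.1 * E e.1
        ≤ ∑' e : goodEdges γ F G, 4 * (otherTargets γ G e.1 * otherSources γ F e.1) := by
          refine ENNReal.tsum_le_tsum fun e => ?_
          calc D e.1 * E e.1 ≤ (otherTargets γ G e.1 + otherTargets γ G e.1) *
                (otherSources γ F e.1 + otherSources γ F e.1) := by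
                rw [← hDsum, ← hEsum]
                gcongr
                · exact e.2.1
                · exact e.2.2
            _ = _ := by ring
      _ ≤ ∑' e, 4 * (otherTargets γ G e * otherSources γ F e) :=
          ENNReal.tsum_comp_le_tsum_of_injective Subtype.val_injective
            fun e => 4 * (otherTargets γ G e * otherSources γ F e)
      _ ≤ 4 * (R * (∑' x, F x) * ∑' y, G y) := by
          rw [ENNReal.tsum_mul_left]
          gcongr
          exact tsum_otherTargets_mul_otherSources_le γ F G hR
      _ ≤ 4 * (R * 1 * 1) := by gcongr
      _ = 4 * R := by ring
  have hFD : ∑' e : goodEdges γ F G, F (e.1.1 - γ e.1.2) * G e.1.1 / D e.1 ≤ 1 := by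
    calc ∑' e : goodEdges γ F G, F (e.1.1 - γ e.1.2) * G e.1.1 / D e.1
        ≤ ∑' e, F (e.1 - γ e.2) * G e.1 / D e :=
          ENNReal.tsum_comp_le_tsum_of_injective Subtype.val_injective
            fun e : A × ι => F (e.1 - γ e.2) * G e.1 / D e
      _ = ∑' x, F x * ((∑ n, G (x + γ n)) / ∑ n, G (x + γ n)) := by
          rw [tsum_prod_shear γ]
          simp [hD, div_eq_mul_inv, Finset.mul_sum, Finset.sum_mul, mul_assoc]
      _ ≤ ∑' x, F x * 1 := by
          gcongr
          exact ENNReal.div_self_le_one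
      _ ≤ 1 := by simpa using hF
  have hGE : ∑' e : goodEdges γ F G, F (e.1.1 - γ e.1.2) * G e.1.1 / E e.1 ≤ 1 := by
    calc ∑' e : goodEdges γ F G, F (e.1.1 - γ e.1.2) * G e.1.1 / E e.1
        ≤ ∑' e, F (e.1 - γ e.2) * G e.1 / E e :=
          ENNReal.tsum_comp_le_tsum_of_injective Subtype.val_injective
            fun e : A × ι => F (e.1 - γ e.2) * G e.1 / E e
      _ = ∑' y, G y * ((∑ n, F (y - γ n)) / ∑ n, F (y - γ n)) := by
          rw [ENNReal.tsum_prod']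
          congr 1 with y
          simp only [hE, tsum_fintype, div_eq_mul_inv, Finset.mul_sum, Finset.sum_mul]
          exact Finset.sum_congr rfl fun n _ => by ring
      _ ≤ ∑' y, G y * 1 := by
          gcongr
          exact ENNReal.div_self_le_one
      _ ≤ 1 := by simpa using hG
  calc ∑' e : goodEdges γ F G, (F (e.1.1 - γ e.1.2) * G e.1.1) ^ (2 / 3 : ℝ)
      ≤ ∑' e : goodEdges γ F G, (D e.1 * E e.1) ^ (1 / 3 : ℝ) *
          (F (e.1.1 - γ e.1.2) * G e.1.1 / D e.1) ^ (1 / 3 : ℝ) *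
          (F (e.1.1 - γ e.1.2) * G e.1.1 / E e.1) ^ (1 / 3 : ℝ) :=
        ENNReal.tsum_le_tsum fun e => rpow_two_thirds_le
          (le_self_add.trans_eq (hEsum e.1)) (le_self_add.trans_eq (hDsum e.1)) (hDt _) (hEt _)
    _ ≤ _ := tsum_rpow_mul_rpow_mul_rpow_le _ _ _ (by norm_num) (by norm_num) (by norm_num)
        (by norm_num)
    _ ≤ (4 * R) ^ (1 / 3 : ℝ) * 1 ^ (1 / 3 : ℝ) * 1 ^ (1 / 3 : ℝ) := by gcongr
    _ = (4 * R) ^ (1 / 3 : ℝ) := by simp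

/-- The bound for the incidence form: the good edges by interpolation from the critical exponents,
the other edges by Hölder's inequality between `(1, 0)` and `(0, 1)`. -/
theorem tsum_incidence_le [DecidableEq A] {N R B : ℝ≥0∞} {D s t : ℝ}
    (hN : 1 ≤ N) (hcard : (Fintype.card ι : ℝ≥0∞) = N)
    (hF : ∑' x, F x ≤ 1) (hG : ∑' y, G y ≤ 1) (hB : 2 ≤ B) (hB' : B ≠ ∞) (hD : 2 ≤ D)
    (hmult : ∀ z, ((Finset.univ.filter fun n => γ n = z).card : ℝ≥0∞) ≤ 2)
    (hR : ∀ v, (((Finset.univ.filter fun n : ι × ι × ι => n.1 ≠ n.2.1 ∧ n.2.2 ≠ n.2.1).filter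
      fun n => γ n.1 - γ n.2.1 + γ n.2.2 = v).card : ℝ≥0∞) ≤ R)
    (hRB : (4 * R) ^ (1 / 3 : ℝ) ≤ B * N ^ (1 - D / 3))
    (hs : 0 ≤ s) (hs1 : s ≤ 1) (ht : 0 ≤ t) (ht1 : t ≤ 1) (hst : 1 ≤ s + t) :
    ∑' e : A × ι, F (e.1 - γ e.2) ^ s * G e.1 ^ t ≤
      2 * B * (N ^ (1 - D * (s + t - 1)) + N ^ (1 - t) + N ^ (1 - s)) := by
  have hN' : N ≠ ∞ := hcard ▸ ENNReal.natCast_ne_top _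
  have hB1 : 1 ≤ B := le_trans (by norm_num) hB
  have hF1 : ∀ x, F x ≤ 1 := fun x => (ENNReal.le_tsum x).trans hF
  have hG1 : ∀ y, G y ≤ 1 := fun y => (ENNReal.le_tsum y).trans hG
  have hsub : ∀ (W : Set (A × ι)) (g : A × ι → ℝ≥0∞), ∑' e : W, g e ≤ ∑' e, g e := fun W g =>
    ENNReal.tsum_comp_le_tsum_of_injective Subtype.val_injective g
  have hFN : ∑' e : A × ι, F (e.1 - γ e.2) ≤ N := by
    rw [tsum_source, hcard]
    exact mul_le_of_le_one_right' hF
  have hGN : ∑' e : A × ι, G e.1 ≤ N := by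
    rw [tsum_target, hcard]
    exact mul_le_of_le_one_right' hG
  have hFG : ∑' e : A × ι, F (e.1 - γ e.2) * G e.1 ≤ B := by
    calc _ ≤ 2 * (∑' x, F x) * ∑' y, G y := tsum_source_mul_target_le γ F G hmult
      _ ≤ 2 * 1 * 1 := by gcongr
      _ ≤ B := by simpa using hB
  set f : A × ι → ℝ≥0∞ := fun e => F (e.1 - γ e.2) ^ s * G e.1 ^ t with hf
  have hgood : ∑' e : goodEdges γ F G, f e ≤
      B * (N ^ (1 - D * (s + t - 1)) + N ^ (1 - t) + N ^ (1 - s)) :=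
    tsum_rpow_mul_rpow_le_of_critical (u := fun e : goodEdges γ F G => F (e.1.1 - γ e.1.2))
      (v := fun e => G e.1.1) hN hN' hB1 hB' hD (fun _ => hF1 _) (fun _ => hG1 _)
      ((hsub _ _).trans hFN) ((hsub _ _).trans hGN)
      ((hsub _ fun e => F (e.1 - γ e.2) * G e.1).trans hFG)
      ((tsum_goodEdges_le γ F G hF hG hR).trans hRB) hs hs1 ht hst
  have htargets : ∑' e : heavyTargets γ G, f e ≤ N ^ (1 - s) := by
    calc ∑' e : heavyTargets γ G, f e
        ≤ ∑' e : heavyTargets γ G, F (e.1.1 - γ e.1.2) ^ s * G e.1.1 ^ (1 - s) := by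
          refine ENNReal.tsum_le_tsum fun e => ?_
          simp only [hf]
          gcongr _ * ?_
          exact ENNReal.rpow_le_rpow_of_exponent_ge (hG1 _) (by linarith)
      _ ≤ (∑' e : heavyTargets γ G, F (e.1.1 - γ e.1.2)) ^ s *
            (∑' e : heavyTargets γ G, G e.1.1) ^ (1 - s) :=
          tsum_rpow_mul_rpow_le _ _ hs (by linarith) (by ring)
      _ ≤ 1 ^ s * N ^ (1 - s) := by
          gcongr
          · exact (tsum_heavyTargets_le γ F G).trans hF
          · exact (hsub _ fun e => G e.1).trans hGN
      _ = N ^ (1 - s) := by simp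
  have hsources : ∑' e : heavySources γ F, f e ≤ N ^ (1 - t) := by
    calc ∑' e : heavySources γ F, f e
        ≤ ∑' e : heavySources γ F, F (e.1.1 - γ e.1.2) ^ (1 - t) * G e.1.1 ^ t := by
          refine ENNReal.tsum_le_tsum fun e => ?_
          simp only [hf]
          gcongr ?_ * _
          exact ENNReal.rpow_le_rpow_of_exponent_ge (hF1 _) (by linarith)
      _ ≤ (∑' e : heavySources γ F, F (e.1.1 - γ e.1.2)) ^ (1 - t) *
            (∑' e : heavySources γ F, G e.1.1) ^ t :=
          tsum_rpow_mul_rpow_le _ _ (by linarith) ht (by ring)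
      _ ≤ N ^ (1 - t) * 1 ^ t := by
          gcongr
          · exact (hsub _ fun e => F (e.1 - γ e.2)).trans hFN
          · exact (tsum_heavySources_le γ F G).trans hG
      _ = N ^ (1 - t) := by simp
  have hcover : (Set.univ : Set (A × ι)) ⊆
      goodEdges γ F G ∪ (heavySources γ F ∪ heavyTargets γ G) := by
    intro e _
    by_cases h1 : G e.1 ≤ otherTargets γ G e
    · by_cases h2 : F (e.1 - γ e.2) ≤ otherSources γ F e
      · exact Or.inl ⟨h1, h2⟩
      · exact Or.inr (Or.inl (not_le.mp h2))
    · exact Or.inr (Or.inr (not_le.mp h1))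
  calc ∑' e, f e = ∑' e : (Set.univ : Set (A × ι)), f e := (tsum_univ f).symm
    _ ≤ ∑' e : ↥(goodEdges γ F G ∪ (heavySources γ F ∪ heavyTargets γ G)), f e :=
        ENNReal.tsum_mono_subtype f hcover
    _ ≤ _ := ENNReal.tsum_union_le f _ _
    _ ≤ _ := add_le_add_right (ENNReal.tsum_union_le f _ _) _
    _ ≤ B * (N ^ (1 - D * (s + t - 1)) + N ^ (1 - t) + N ^ (1 - s)) +
          (N ^ (1 - t) + N ^ (1 - s)) := by gcongr
    _ ≤ B * (N ^ (1 - D * (s + t - 1)) + N ^ (1 - t) + N ^ (1 - s)) +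
          B * (N ^ (1 - D * (s + t - 1)) + N ^ (1 - t) + N ^ (1 - s)) := by
        gcongr
        rw [add_assoc]
        exact le_add_self.trans (le_mul_of_one_le_left' hB1)
    _ = _ := by ring

end Incidence

/-! ### From the incidence form to `ℓ^p → ℓ^q` bounds -/

theorem ellNorm_eq_tsum {d : ℕ} {p : ℝ≥0∞} (hp0 : p ≠ 0) (hp : p ≠ ∞) (f : (Fin d → ℤ) → ℂ) :
    ellNorm p f = (∑' x, ‖f x‖ₑ ^ p.toReal) ^ (p⁻¹).toReal := by
  rw [ellNorm, MeasureTheory.eLpNorm_eq_lintegral_rpow_enorm_toReal hp0 hp,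
    MeasureTheory.lintegral_count, ENNReal.toReal_inv, one_div]

/-- The case `p = q`: averages of translates are contractions of `ℓ^p`. -/
theorem ellNorm_average_le {d : ℕ} (P : Fin d → Polynomial ℤ) {N : ℕ} (hN : 1 ≤ N) {p : ℝ≥0∞}
    (hp : 1 ≤ p) (f : (Fin d → ℤ) → ℂ) : ellNorm p (average P N f) ≤ ellNorm p f := by
  have h1 : average P N f = (1 / (N : ℂ)) • ∑ n ∈ Finset.Icc 1 N,
      f ∘ fun x => x - curve P ((n : ℕ) : ℤ) := by
    ext x
    simp [average]
  have h2 : ∀ z : Fin d → ℤ, MeasureTheory.eLpNorm (f ∘ fun x => x - z) p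
      MeasureTheory.Measure.count = MeasureTheory.eLpNorm f p MeasureTheory.Measure.count :=
    fun z => MeasureTheory.eLpNorm_comp_measurePreserving
      (Measurable.of_discrete).aestronglyMeasurable
      (MeasureTheory.measurePreserving_sub_right _ z)
  have hN0 : (N : ℝ≥0∞) ≠ 0 := by exact_mod_cast (by omega : N ≠ 0)
  rw [h1, ellNorm, ellNorm]
  calc _ ≤ ‖1 / (N : ℂ)‖ₑ * MeasureTheory.eLpNorm (∑ n ∈ Finset.Icc 1 N,
        f ∘ fun x => x - curve P ((n : ℕ) : ℤ)) p MeasureTheory.Measure.count :=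
        MeasureTheory.eLpNorm_const_smul_le
    _ ≤ ‖1 / (N : ℂ)‖ₑ * ∑ n ∈ Finset.Icc 1 N, MeasureTheory.eLpNorm
        (f ∘ fun x => x - curve P ((n : ℕ) : ℤ)) p MeasureTheory.Measure.count := by
        gcongr
        exact MeasureTheory.eLpNorm_sum_le
          (fun _ _ => (Measurable.of_discrete).aestronglyMeasurable) hp
    _ = ((N : ℝ≥0∞)⁻¹ * N) * MeasureTheory.eLpNorm f p MeasureTheory.Measure.count := by
        simp only [h2, Finset.sum_const, Nat.card_Icc, nsmul_eq_mul, Nat.add_sub_cancel]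
        rw [← mul_assoc, one_div, enorm_inv (by exact_mod_cast (by omega : N ≠ 0))]
        simp [enorm_eq_nnnorm]
    _ = _ := by
        rw [ENNReal.inv_mul_cancel hN0 (ENNReal.natCast_ne_top N), one_mul]

/-- Duality: the `ℓ^q` norm is controlled by the pairings with functions `G ^ (1 - 1/q)`, where `G`
has mass at most one. -/
theorem ellNorm_le_of_pairing_le {d : ℕ} {q : ℝ≥0∞} (hq : 1 < q) (h : (Fin d → ℤ) → ℂ) (K : ℝ≥0∞)
    (hK : ∀ G : (Fin d → ℤ) → ℝ≥0∞, ∑' y, G y ≤ 1 →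
      ∑' y, ‖h y‖ₑ * G y ^ (1 - (q⁻¹).toReal) ≤ K) :
    ellNorm q h ≤ K := by
  rcases eq_or_ne q ∞ with rfl | hqt
  · rw [ellNorm, MeasureTheory.eLpNorm_exponent_top, MeasureTheory.eLpNormEssSup_count]
    refine iSup_le fun y => ?_
    have h1 := hK (Pi.single y 1) (tsum_pi_single y (1 : ℝ≥0∞)).le
    refine le_trans ?_ ((ENNReal.le_tsum y).trans h1)
    simp
  have hq0 : q ≠ 0 := (zero_lt_one.trans hq).ne'
  have hr : 1 < q.toReal := by
    rw [← ENNReal.toReal_one]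
    exact (ENNReal.toReal_lt_toReal ENNReal.one_ne_top hqt).mpr hq
  set r := q.toReal
  have hr0 : 0 < r := by linarith
  have hinv : (q⁻¹).toReal = r⁻¹ := ENNReal.toReal_inv q
  have hr1 : 0 < 1 - r⁻¹ := sub_pos.mpr (inv_lt_one_of_one_lt₀ hr)
  rw [ellNorm_eq_tsum hq0 hqt, hinv, ENNReal.rpow_inv_le_iff hr0, ENNReal.tsum_eq_iSup_sum]
  refine iSup_le fun S => ?_
  set M := ∑ y ∈ S, ‖h y‖ₑ ^ r with hM
  rcases eq_or_ne M 0 with hM0 | hM0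
  · rw [hM0]; exact zero_le
  have hMt : M ≠ ∞ := ENNReal.sum_ne_top.mpr fun y _ =>
    ENNReal.rpow_ne_top_of_nonneg hr0.le enorm_ne_top
  -- The extremizer of the duality, cut off to `S` because `∑ |h| ^ q` may be infinite.
  have hG := hK (fun y => if y ∈ S then ‖h y‖ₑ ^ r / M else 0) (by
    rw [tsum_eq_sum (s := S) fun y hy => if_neg hy, Finset.sum_congr rfl fun y hy => if_pos hy]
    simp only [div_eq_mul_inv]
    rw [← Finset.sum_mul, ← hM, ENNReal.mul_inv_cancel hM0 hMt])
  rw [← ENNReal.rpow_inv_le_iff hr0]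
  refine le_trans (le_of_eq ?_) hG
  rw [hinv, tsum_eq_sum (s := S) fun y hy => by simp [hy, hr1]]
  have hterm : ∀ y ∈ S, ‖h y‖ₑ * (if y ∈ S then ‖h y‖ₑ ^ r / M else 0) ^ (1 - r⁻¹) =
      ‖h y‖ₑ ^ r * M ^ (-(1 - r⁻¹)) := by
    intro y hy
    rw [if_pos hy, ENNReal.div_rpow_of_nonneg _ _ hr1.le, ← ENNReal.rpow_mul, ENNReal.rpow_neg,
      div_eq_mul_inv, ← mul_assoc]
    congr 1
    calc ‖h y‖ₑ * ‖h y‖ₑ ^ (r * (1 - r⁻¹)) = ‖h y‖ₑ ^ (1 : ℝ) * ‖h y‖ₑ ^ (r * (1 - r⁻¹)) := by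
          rw [ENNReal.rpow_one]
      _ = ‖h y‖ₑ ^ (1 + r * (1 - r⁻¹)) :=
          (ENNReal.rpow_add_of_nonneg _ _ zero_le_one (by positivity)).symm
      _ = ‖h y‖ₑ ^ r := by
          congr 1
          field_simp
          ring
  rw [Finset.sum_congr rfl hterm, ← Finset.sum_mul, ← hM]
  calc M ^ r⁻¹ = M ^ (1 + -(1 - r⁻¹)) := by ring_nf
    _ = M * M ^ (-(1 - r⁻¹)) := by rw [ENNReal.rpow_add _ _ hM0 hMt, ENNReal.rpow_one]

/-- A bound for the incidence form bounds the averages. -/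
theorem ellNorm_average_le_of_incidence {d : ℕ} (P : Fin d → Polynomial ℤ) {N : ℕ} {p q : ℝ≥0∞}
    (hp : 1 ≤ p) (hpt : p ≠ ∞) (hq : 1 < q) (K : ℝ≥0∞)
    (hK : ∀ F G : (Fin d → ℤ) → ℝ≥0∞, ∑' x, F x ≤ 1 → ∑' y, G y ≤ 1 →
      ∑' e : (Fin d → ℤ) × Finset.Icc 1 N, F (e.1 - curve P ((e.2 : ℕ) : ℤ)) ^ (p⁻¹).toReal *
        G e.1 ^ (1 - (q⁻¹).toReal) ≤ K)
    (f : (Fin d → ℤ) → ℂ) (hf : ellNorm p f < ∞) :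
    ellNorm q (average P N f) ≤ (N : ℝ≥0∞)⁻¹ * K * ellNorm p f := by
  have hp0 : p ≠ 0 := (zero_lt_one.trans_le hp).ne'
  have hr0 : 0 < p.toReal := ENNReal.toReal_pos hp0 hpt
  set L := ellNorm p f with hL
  rcases eq_or_ne L 0 with hL0 | hL0
  · have hfz : f = 0 := by
      ext x
      have := MeasureTheory.enorm_le_eLpNorm_count f x hp0
      rw [← ellNorm, ← hL, hL0] at this
      simpa using this
    have : average P N f = 0 := by
      ext x
      simp [average, hfz]
    rw [this]
    simp [ellNorm]
  have hLp : L ^ p.toReal = ∑' x, ‖f x‖ₑ ^ p.toReal := by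
    rw [hL, ellNorm_eq_tsum hp0 hpt, ENNReal.toReal_inv, ENNReal.rpow_inv_rpow hr0.ne']
  have hLp0 : L ^ p.toReal ≠ 0 := by simp [hL0, hf.ne]
  have hLpt : L ^ p.toReal ≠ ∞ := ENNReal.rpow_ne_top_of_nonneg hr0.le hf.ne
  set F : (Fin d → ℤ) → ℝ≥0∞ := fun x => ‖f x‖ₑ ^ p.toReal / L ^ p.toReal with hF
  have hF1 : ∑' x, F x ≤ 1 := by
    simp only [hF, div_eq_mul_inv]
    rw [ENNReal.tsum_mul_right, ← hLp, ENNReal.mul_inv_cancel hLp0 hLpt]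
  have hFs : ∀ x, ‖f x‖ₑ = L * F x ^ (p⁻¹).toReal := by
    intro x
    rw [hF, ENNReal.toReal_inv]
    simp only []
    rw [ENNReal.div_rpow_of_nonneg _ _ (by positivity), ENNReal.rpow_rpow_inv hr0.ne',
      ENNReal.rpow_rpow_inv hr0.ne', ENNReal.mul_div_cancel hL0 hf.ne]
  have hpt' : ∀ y, ‖average P N f y‖ₑ ≤ (N : ℝ≥0∞)⁻¹ * L *
      ∑ n : Finset.Icc 1 N, F (y - curve P ((n : ℕ) : ℤ)) ^ (p⁻¹).toReal := by
    intro y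
    rcases Nat.eq_zero_or_pos N with rfl | hN
    · simp [average]
    rw [average, enorm_mul, mul_assoc, Finset.mul_sum]
    gcongr ?_ * ?_
    · rw [one_div, enorm_inv (by exact_mod_cast hN.ne')]
      simp [enorm_eq_nnnorm]
    · refine (enorm_sum_le _ _).trans_eq ?_
      rw [← Finset.sum_coe_sort]
      exact Finset.sum_congr rfl fun n _ => hFs _
  refine ellNorm_le_of_pairing_le hq _ _ fun G hG => ?_
  calc ∑' y, ‖average P N f y‖ₑ * G y ^ (1 - (q⁻¹).toReal)
      ≤ ∑' y, (N : ℝ≥0∞)⁻¹ * L * ∑ n : Finset.Icc 1 N,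
          (F (y - curve P ((n : ℕ) : ℤ)) ^ (p⁻¹).toReal * G y ^ (1 - (q⁻¹).toReal)) := by
        refine ENNReal.tsum_le_tsum fun y => ?_
        rw [← Finset.sum_mul, ← mul_assoc]
        gcongr
        exact hpt' y
    _ = (N : ℝ≥0∞)⁻¹ * L * ∑' e : (Fin d → ℤ) × Finset.Icc 1 N,
          F (e.1 - curve P ((e.2 : ℕ) : ℤ)) ^ (p⁻¹).toReal * G e.1 ^ (1 - (q⁻¹).toReal) := by
        rw [ENNReal.tsum_mul_left, ENNReal.tsum_prod']
        simp only [tsum_fintype]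
    _ ≤ (N : ℝ≥0∞)⁻¹ * L * K := by gcongr; exact hK F G hF1 hG
    _ = (N : ℝ≥0∞)⁻¹ * K * L := by ring

theorem one_le_optimalConstant_self (D N : ℕ) (p : ℝ≥0∞) : 1 ≤ optimalConstant D N p p := by
  simp only [optimalConstant, sub_self, mul_zero, neg_zero, Real.rpow_zero]
  have h1 : 0 ≤ (N : ℝ) ^ (-(1 - (p⁻¹).toReal)) := by positivity
  have h2 : 0 ≤ (N : ℝ) ^ (-(p⁻¹).toReal) := by positivity
  linarith

theorem ofReal_natCast_rpow {N : ℕ} (hN : 1 ≤ N) (x : ℝ) :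
    ENNReal.ofReal ((N : ℝ) ^ x) = (N : ℝ≥0∞) ^ x := by
  rw [← ENNReal.ofReal_rpow_of_pos (by exact_mod_cast hN), ENNReal.ofReal_natCast]

theorem inv_mul_eq_ofReal_optimalConstant {D N : ℕ} (hN : 1 ≤ N) {p q : ℝ≥0∞} :
    (N : ℝ≥0∞)⁻¹ *
      ((N : ℝ≥0∞) ^ (1 - (D : ℝ) * ((p⁻¹).toReal + (1 - (q⁻¹).toReal) - 1)) +
        (N : ℝ≥0∞) ^ (1 - (1 - (q⁻¹).toReal)) + (N : ℝ≥0∞) ^ (1 - (p⁻¹).toReal)) =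
      ENNReal.ofReal (optimalConstant D N p q) := by
  have hN0 : (N : ℝ≥0∞) ≠ 0 := by exact_mod_cast (by omega : N ≠ 0)
  have hinv : ∀ x : ℝ, (N : ℝ≥0∞)⁻¹ * (N : ℝ≥0∞) ^ (1 - x) = ENNReal.ofReal ((N : ℝ) ^ (-x)) := by
    intro x
    rw [ofReal_natCast_rpow hN, ← ENNReal.rpow_neg_one,
      ← ENNReal.rpow_add _ _ hN0 (ENNReal.natCast_ne_top N)]
    ring_nf
  rw [optimalConstant, ENNReal.ofReal_add (by positivity) (by positivity),
    ENNReal.ofReal_add (by positivity) (by positivity), mul_add, mul_add, hinv, hinv, hinv]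
  ring_nf

/-- The optimal bounds hold as soon as a point has at most two representations `γ(n)`
and `O(N ^ (3 - D + ε))` representations as `γ(n₁) - γ(n₂) + γ(n₃)` with
`n₁ ≠ n₂ ≠ n₃`. -/
theorem optimalBounds_of_card_walks_le {d : ℕ} (P : Fin d → Polynomial ℤ)
    (hD : 2 ≤ totalDegree P)
    (hmult : ∀ (N : ℕ) (z : Fin d → ℤ),
      ((Finset.Icc 1 N).filter fun n : ℕ => curve P (n : ℤ) = z).card ≤ 2)
    (hwalk : ∀ ε : ℝ, 0 < ε → ∃ C : ℝ, 1 ≤ C ∧ ∀ (N : ℕ) (v : Fin d → ℤ), 1 ≤ N →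
      (((walks N).filter fun n => curve P n.1 - curve P n.2.1 + curve P n.2.2 = v).card : ℝ) ≤
        C * (N : ℝ) ^ (3 - (totalDegree P : ℝ) + ε)) :
    OptimalBounds P := by
  intro ε hε
  obtain ⟨C, hC1, hC⟩ := hwalk ε hε
  refine ⟨8 * C, by linarith, fun p q hp hpq N hN f hf => ?_⟩
  have hN1 : (1 : ℝ) ≤ N := by exact_mod_cast hN
  have hNε : 1 ≤ (N : ℝ) ^ ε := Real.one_le_rpow hN1 hε.le
  rcases hpq.eq_or_lt with rfl | hlt
  · refine (ellNorm_average_le P hN hp f).trans (le_mul_of_one_le_left' ?_)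
    rw [ENNReal.one_le_ofReal]
    have := one_le_optimalConstant_self (totalDegree P) N p
    have h8 : 1 ≤ 8 * C * (N : ℝ) ^ ε := by nlinarith
    nlinarith
  have hpt : p ≠ ∞ := hlt.ne_top
  have hq : 1 < q := hp.trans_lt hlt
  set D : ℝ := (totalDegree P : ℝ) with hDdef
  set R : ℝ≥0∞ := ENNReal.ofReal (C * (N : ℝ) ^ (3 - D + ε)) with hR
  set B : ℝ≥0∞ := ENNReal.ofReal (4 * C * (N : ℝ) ^ ε) with hB
  have hB2 : 2 ≤ B := by
    rw [hB, ← ENNReal.ofReal_ofNat]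
    apply ENNReal.ofReal_le_ofReal
    nlinarith
  have hRB : (4 * R) ^ (1 / 3 : ℝ) ≤ B * (N : ℝ≥0∞) ^ (1 - D / 3) := by
    have h4 : 4 * R = ENNReal.ofReal (4 * (C * (N : ℝ) ^ (3 - D + ε))) := by
      rw [ENNReal.ofReal_mul (by norm_num), ENNReal.ofReal_ofNat]
    rw [h4, ← ofReal_natCast_rpow hN, ← ENNReal.ofReal_mul (by positivity),
      ENNReal.ofReal_rpow_of_nonneg (by positivity) (by norm_num)]
    apply ENNReal.ofReal_le_ofReal
    have h1 : 4 * (C * (N : ℝ) ^ (3 - D + ε)) = (4 * C * (N : ℝ) ^ ε) * (N : ℝ) ^ (3 - D) := by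
      rw [Real.rpow_add (by positivity)]
      ring
    rw [h1, Real.mul_rpow (by positivity) (by positivity), ← Real.rpow_mul (by positivity)]
    have h2 : (4 * C * (N : ℝ) ^ ε) ^ (1 / 3 : ℝ) ≤ (4 * C * (N : ℝ) ^ ε) ^ (1 : ℝ) :=
      Real.rpow_le_rpow_of_exponent_le (by nlinarith) (by norm_num)
    rw [Real.rpow_one] at h2
    rw [show (3 - D) * (1 / 3) = 1 - D / 3 by ring]
    gcongr
  have hs1 : (p⁻¹).toReal ≤ 1 := by
    simpa using ENNReal.toReal_mono ENNReal.one_ne_top (ENNReal.inv_le_one.mpr hp)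
  have ht0 : (q⁻¹).toReal ≤ 1 := by
    simpa using ENNReal.toReal_mono ENNReal.one_ne_top (ENNReal.inv_le_one.mpr hq.le)
  have hst : (q⁻¹).toReal ≤ (p⁻¹).toReal :=
    ENNReal.toReal_mono (ENNReal.inv_ne_top.mpr (zero_lt_one.trans_le hp).ne')
      (ENNReal.inv_le_inv.mpr hpq)
  have hmult' : ∀ z, ((Finset.univ.filter fun n : Finset.Icc 1 N =>
      curve P ((n : ℕ) : ℤ) = z).card : ℝ≥0∞) ≤ 2 := by
    intro z
    have : (Finset.univ.filter fun n : Finset.Icc 1 N => curve P ((n : ℕ) : ℤ) = z).card ≤ 2 :=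
      (Finset.card_le_card_of_injOn Subtype.val (fun n hn => by
        simpa using ⟨Finset.mem_Icc.mp n.2, (Finset.mem_filter.mp hn).2⟩)
        Subtype.val_injective.injOn).trans (hmult N z)
    exact_mod_cast this
  have hwalk' : ∀ v, (((Finset.univ.filter fun n : Finset.Icc 1 N × Finset.Icc 1 N ×
      Finset.Icc 1 N => n.1 ≠ n.2.1 ∧ n.2.2 ≠ n.2.1).filter fun n =>
        curve P ((n.1 : ℕ) : ℤ) - curve P ((n.2.1 : ℕ) : ℤ) + curve P ((n.2.2 : ℕ) : ℤ) = v).card :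
          ℝ≥0∞) ≤ R := by
    intro v
    refine le_trans (Nat.cast_le.mpr (Finset.card_le_card_of_injOn
      (t := (walks N).filter fun n => curve P n.1 - curve P n.2.1 + curve P n.2.2 = v)
      (fun n => ((n.1 : ℕ), (n.2.1 : ℕ), (n.2.2 : ℕ))) ?_ ?_)) ?_
    · rintro ⟨a, b, c⟩ hn
      obtain ⟨hn, hv⟩ := Finset.mem_filter.mp hn
      obtain ⟨-, hab, hcb⟩ := Finset.mem_filter.mp hn
      exact Finset.mem_filter.mpr ⟨mem_walks.mpr ⟨⟨Finset.mem_Icc.mp a.2, Finset.mem_Icc.mp b.2,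
        Finset.mem_Icc.mp c.2⟩, fun h => hab (Subtype.ext h), fun h => hcb (Subtype.ext h)⟩, hv⟩
    · rintro ⟨a, b, c⟩ - ⟨a', b', c'⟩ - h
      simp only [Prod.mk.injEq] at h
      exact Prod.ext (Subtype.ext h.1) (Prod.ext (Subtype.ext h.2.1) (Subtype.ext h.2.2))
    · rw [hR, ← ENNReal.ofReal_natCast]
      exact ENNReal.ofReal_le_ofReal (hC N v hN)
  have hmain := ellNorm_average_le_of_incidence P hp hpt hq _ (fun F G hF hG =>
    tsum_incidence_le (fun n : Finset.Icc 1 N => curve P ((n : ℕ) : ℤ)) F G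
      (N := N) (D := D) (s := (p⁻¹).toReal) (t := 1 - (q⁻¹).toReal)
      (by exact_mod_cast hN) (by simp) hF hG hB2 ENNReal.ofReal_ne_top
      (by rw [hDdef]; exact_mod_cast hD) hmult' hwalk' hRB ENNReal.toReal_nonneg hs1
      (by linarith) (by linarith [ENNReal.toReal_nonneg (a := q⁻¹)]) (by linarith)) f hf
  refine hmain.trans_eq ?_
  congr 1
  rw [mul_left_comm, inv_mul_eq_ofReal_optimalConstant hN, hB,
    show (2 : ℝ≥0∞) = ENNReal.ofReal 2 by simp, ← ENNReal.ofReal_mul (by norm_num),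
    ← ENNReal.ofReal_mul (by positivity)]
  congr 1
  ring

theorem card_curve_eq_le_two {d : ℕ} {P : Fin d → Polynomial ℤ} (j : Fin d)
    (hj : (P j).natDegree = 2) (N : ℕ) (z : Fin d → ℤ) :
    ((Finset.Icc 1 N).filter fun n : ℕ => curve P (n : ℤ) = z).card ≤ 2 :=
  (Finset.card_le_card fun _ hn => Finset.mem_filter.mpr
    ⟨(Finset.mem_filter.mp hn).1, congrFun (Finset.mem_filter.mp hn).2 j⟩).trans
    (card_eval_eq_le_two hj N (z j))

end PolyAvg

theorem corollary1 :
    (∀ P : Fin 1 → Polynomial ℤ, (P 0).natDegree = 2 → PolyAvg.OptimalBounds P) ∧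
    (∀ P : Fin 2 → Polynomial ℤ, (P 0).natDegree = 1 → (P 1).natDegree = 2 →
      PolyAvg.OptimalBounds P) := by
  refine ⟨fun P h0 => ?_, fun P h0 h1 => ?_⟩
  · have hD : PolyAvg.totalDegree P = 2 := by simp [PolyAvg.totalDegree, h0]
    refine PolyAvg.optimalBounds_of_card_walks_le P hD.ge (PolyAvg.card_curve_eq_le_two 0 h0)
      fun ε hε => ?_
    obtain ⟨C, hC1, hC⟩ := PolyAvg.card_walks_quadratic_le hε
    refine ⟨C, hC1, fun N v hN => ?_⟩
    rw [hD]
    exact_mod_cast hC P h0 N v hN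
  · have hD : PolyAvg.totalDegree P = 3 := by simp [PolyAvg.totalDegree, h0, h1]
    refine PolyAvg.optimalBounds_of_card_walks_le P (by omega)
      (PolyAvg.card_curve_eq_le_two 1 h1) fun ε hε => ?_
    obtain ⟨C, hC1, hC⟩ := PolyAvg.card_walks_curve_parabola_le hε
    refine ⟨C, hC1, fun N v hN => ?_⟩
    rw [hD]
    exact_mod_cast hC P h0 h1 N v hN
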